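/- \textbf{Proposition (Consistency of generalized Wasserstein barycenters).} Let $(M,g)$ be a complete, connected, finite-dimensional smooth Riemannian manifold without boundary, with geodesic distance $d$. Let $h:[0,\infty)\to[0,\infty)$ satisfy $h(0)=0$, $h\in C^2((0,\infty))$, $\lim_{t\downarrow0}h(t)/t=0$, and $h'(t)>0$, $h''(t)>0$ for all $t>0$. For Borel probability measures $\mu,\nu\in\mathcal P(M)$ put \[ \mathcal T_c(\mu,\nu):=\inf_{\gamma\in\Pi(\mu,\nu)}\int_{M\times M}h(d(x,y))\,d\gamma(x,y)\in[0,\infty], \] where $\Pi(\mu,\nu)$ is the set of probability measures on $M\times M$ with marginals $\mu,\nu$, and let $\mathcal W_h(M)$ be the set of $\mu\in\mathcal P(M)$ with $\int_M h(d(x_0,x))\,d\mu(x)<\infty$ for some $x_0\in M$. Let $n\ge2$ and let $\lambda_1,\dots,\lambda_n>0$ with $\sum_{i=1}^n\lambda_i=1$. A \emph{barycenter} of $\sum_{i}\lambda_i\delta_{\mu_i}$ is a minimizer of $\nu\mapsto\sum_{i=1}^n\lambda_i\,\mathcal T_c(\nu,\mu_i)$ over $\nu\in\mathcal W_h(M)$.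 A \emph{measurable barycenter selection} is a Borel map $B:M^n\to M$ such that, for every $(x_1,\dots,x_n)\in M^n$, the point $B(x_1,\dots,x_n)$ minimizes $y\mapsto\sum_i\lambda_i h(d(y,x_i))$ over $M$. Set $C(x_1,\dots,x_n):=\inf_{y\in M}\sum_i\lambda_i h(d(y,x_i))$. Let $\mu_1,\dots,\mu_n\in\mathcal P(M)$ and, for each $i$, let $(\mu_i^j)_{j\ge1}\subset\mathcal P(M)$ converge weakly to $\mu_i$. Assume that there is a compact set $K\subset M$ containing $\operatorname{supp}\mu_i$ and $\operatorname{supp}\mu_i^j$ for all $1\le i\le n$ and $j\ge1$. For each $j\ge 1$ let $\nu^j=(B^j)_\#\gamma^j$, where $B^j$ is a measurable barycenter selection and $\gamma^j$ minimizes $\int_{M^n}C\,d\gamma$ over all probability measures $\gamma$ on $M^n$ with marginals $\mu_1^j,\dots,\mu_n^j$. (Such $\nu^j$ is a barycenter of $\sum_i\lambda_i\delta_{\mu_i^j}$.) Then there is a subsequence of $(\nu^j)_{j\ge1}$ that converges weakly to a barycenter of $\sum_{i=1}^n\lambda_i\delta_{\mu_i}$. -/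

import Mathlib

open MeasureTheory Filter Topology
open scoped ContDiff Manifold Bundle

namespace HBarycenter

/-- The standing assumptions on the profile `h : [0, ∞) → [0, ∞)` of the cost: `h 0 = 0`, `h` is
`C²` on `(0, ∞)`, the right derivative of `h` at `0` vanishes, and `h' > 0`, `h'' > 0` on `(0, ∞)`.
The function is given on all of `ℝ`, but only its values on `[0, ∞)` matter. (Nonnegativity on
`[0, ∞)` follows from these conditions.) -/
structure IsCostProfile (h : ℝ → ℝ) : Prop where
  map_zero : h 0 = 0
  contDiffOn : ContDiffOn ℝ 2 h (Set.Ioi 0)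
  tendsto_div : Tendsto (fun t : ℝ => h t / t) (𝓝[>] 0) (𝓝 0)
  deriv_pos : ∀ t : ℝ, 0 < t → 0 < deriv h t
  deriv_deriv_pos : ∀ t : ℝ, 0 < t → 0 < deriv (deriv h) t

section Points

variable {X : Type*} [MetricSpace X] {n : ℕ}

/-- The objective `Φ(x, y) = ∑ᵢ λᵢ h(d(y, xᵢ))`. -/
def pointObjective (h : ℝ → ℝ) (w : Fin n → ℝ) (x : Fin n → X) (y : X) : ℝ :=
  ∑ i, w i * h (dist y (x i))

/-- `z` is an `h`-barycenter of `∑ᵢ λᵢ δ_{xᵢ}`. -/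
def IsPointBarycenter (h : ℝ → ℝ) (w : Fin n → ℝ) (x : Fin n → X) (z : X) : Prop :=
  ∀ y : X, pointObjective h w x z ≤ pointObjective h w x y

/-- The multi-marginal cost `C(x₁, …, xₙ) = inf_y ∑ᵢ λᵢ h(d(y, xᵢ))`. -/
noncomputable def multiCost (h : ℝ → ℝ) (w : Fin n → ℝ) (x : Fin n → X) : ℝ :=
  ⨅ y : X, pointObjective h w x y

end Points

section Transport

variable {X : Type*} [MetricSpace X] [MeasurableSpace X] {n : ℕ}

/-- The set `Π(μ, ν)` of transport plans. -/
def plans (μ ν : ProbabilityMeasure X) : Set (ProbabilityMeasure (X × X)) :=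
  {γ | (γ : Measure (X × X)).map Prod.fst = μ ∧ (γ : Measure (X × X)).map Prod.snd = ν}

/-- The optimal transport cost `𝒯_c(μ, ν)` for the cost `c(x, y) = h(d(x, y))`, in `[0, ∞]`. -/
noncomputable def transportCost (h : ℝ → ℝ) (μ ν : ProbabilityMeasure X) : ENNReal :=
  ⨅ γ ∈ plans μ ν, ∫⁻ p, ENNReal.ofReal (h (dist p.1 p.2)) ∂(γ : Measure (X × X))

/-- The set `𝒲_h` of probability measures with finite `h`-moment. -/
def finiteMoment (h : ℝ → ℝ) : Set (ProbabilityMeasure X) :=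
  {μ | ∃ x₀ : X, ∫⁻ x, ENNReal.ofReal (h (dist x₀ x)) ∂(μ : Measure X) < ⊤}

/-- The functional `ν ↦ ∑ᵢ λᵢ 𝒯_c(ν, μᵢ)`. -/
noncomputable def barycenterFunctional (h : ℝ → ℝ) (w : Fin n → ℝ)
    (μ : Fin n → ProbabilityMeasure X) (ν : ProbabilityMeasure X) : ENNReal :=
  ∑ i, ENNReal.ofReal (w i) * transportCost h ν (μ i)

/-- `ν` is a (generalized Wasserstein) barycenter of `∑ᵢ λᵢ δ_{μᵢ}`: it minimizes
`∑ᵢ λᵢ 𝒯_c(·, μᵢ)` over `𝒲_h`. -/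
def IsWassersteinBarycenter (h : ℝ → ℝ) (w : Fin n → ℝ)
    (μ : Fin n → ProbabilityMeasure X) (ν : ProbabilityMeasure X) : Prop :=
  IsMinOn (barycenterFunctional h w μ) (finiteMoment h) ν ∧ ν ∈ finiteMoment h

/-- The set `Π(μ₁, …, μₙ)` of multi-marginal transport plans. -/
def multiPlans (μ : Fin n → ProbabilityMeasure X) : Set (ProbabilityMeasure (Fin n → X)) :=
  {γ | ∀ i, (γ : Measure (Fin n → X)).map (fun x => x i) = μ i}

/-- `γ` solves the multi-marginal optimal transport problem for the cost `C`. -/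
def IsOptimalMultiPlan (h : ℝ → ℝ) (w : Fin n → ℝ)
    (μ : Fin n → ProbabilityMeasure X) (γ : ProbabilityMeasure (Fin n → X)) : Prop :=
  γ ∈ multiPlans μ ∧
    IsMinOn (fun γ' : ProbabilityMeasure (Fin n → X) =>
      ∫⁻ x, ENNReal.ofReal (multiCost h w x) ∂(γ' : Measure (Fin n → X))) (multiPlans μ) γ

/-- `B` is a measurable barycenter selection map. -/
def IsBarycenterSelection (h : ℝ → ℝ) (w : Fin n → ℝ) (B : (Fin n → X) → X) : Prop :=
  Measurable B ∧ ∀ x, IsPointBarycenter h w x (B x)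

/-- `ν = B_# γ` for some solution `γ` of the multi-marginal problem and some measurable barycenter
selection map `B`. -/
def IsConstructedBarycenter (h : ℝ → ℝ) (w : Fin n → ℝ)
    (μ : Fin n → ProbabilityMeasure X) (ν : ProbabilityMeasure X) : Prop :=
  ∃ (γ : ProbabilityMeasure (Fin n → X)) (B : (Fin n → X) → X),
    IsOptimalMultiPlan h w μ γ ∧ IsBarycenterSelection h w B ∧
      (ν : Measure X) = (γ : Measure (Fin n → X)).map B

end Transport

end HBarycenter

/-! The argument lifts everything to couplings on `M × Mⁿ`. Let `Φ` be `pointObjective`, `C` be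
`multiCost`, and `F_μ` the barycenter functional; put `ηʲ = (Bʲ, id)_# γʲ`. By Hopf–Rinow `M` is
proper, so barycenters of points of `K` stay in a compact set `L`. Hence the `ηʲ` live on `L × Kⁿ`,
and Prokhorov's theorem yields a limit `η` along a subsequence. Its first marginal is the candidate,
and its other marginals are the `μᵢ`. The maps `Bʲ` themselves need not converge.

Optimality comes from two bounds. `F_μ(ν) ≤ ∫ Φ dη` when `η` has marginals `ν, μ₁, …, μₙ`, and `∫ C
dγ ≤ F_μ(ν')` for optimal `γ` and every `ν'`, by gluing near-optimal plans along `ν'`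
(`exists_gluing`). Since `∫ Φ dηʲ = ∫ C dγʲ`, lower semicontinuity bounds `F_μ` at the limit by
`liminf ∫ C dγʲ`. To compare with `ν'`, replace it by `ν'' = B_# σ`, with `σ` a plan glued from
`ν'`: this is carried by `L` and costs at most `F_μ(ν') + ε/2`. For this fixed `ν''`, `F` is upper
semicontinuous in the targets (`eventually_exists_plan_lintegral_le`), which closes the chain
without duality. -/

namespace HBarycenter

/-! ### Hopf–Rinow: properness of the manifold -/

/-- A complete locally compact metric space in which distances are approximately realised by
intermediate points is proper (Hopf–Rinow–Cohn-Vossen). -/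
theorem properSpace_of_exists_between {X : Type*} [MetricSpace X] [CompleteSpace X]
    [LocallyCompactSpace X]
    (hX : ∀ (x y : X) (r s : ℝ), 0 ≤ r → 0 < s → dist x y < r + s →
      ∃ z, dist x z ≤ r ∧ dist z y < s) : ProperSpace X := by
  refine ⟨fun x R => ?_⟩
  have hstep : ∀ r, 0 ≤ r → IsCompact (Metric.closedBall x r) →
      ∃ δ > 0, IsCompact (Metric.closedBall x (r + δ)) := by
    intro r hr hc
    obtain ⟨K, hK, hsub⟩ := exists_compact_superset hc
    obtain ⟨δ, hδ, hδK⟩ := hc.exists_thickening_subset_open isOpen_interior hsub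
    refine ⟨δ / 2, by positivity, hK.of_isClosed_subset Metric.isClosed_closedBall fun y hy => ?_⟩
    rw [Metric.mem_closedBall, dist_comm] at hy
    obtain ⟨z, hz, hzy⟩ := hX x y r δ hr hδ (by linarith)
    refine interior_subset (hδK (Metric.mem_thickening_iff.2 ⟨z, ?_, by rwa [dist_comm]⟩))
    rwa [Metric.mem_closedBall, dist_comm]
  -- The ball of radius `r` lies in the `ε/2`-neighbourhood of a slightly smaller compact ball, so a
  -- finite `ε/2`-net of the latter is an `ε`-net of the former.
  have hlim : ∀ r, 0 ≤ r → (∀ s < r, IsCompact (Metric.closedBall x s)) →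
      IsCompact (Metric.closedBall x r) := by
    intro r hr hs
    rcases hr.eq_or_lt with rfl | hr
    · simp
    refine isCompact_iff_totallyBounded_isComplete.2
      ⟨Metric.totallyBounded_iff.2 fun ε hε => ?_, Metric.isClosed_closedBall.isComplete⟩
    obtain ⟨s, hs0, hsr, hsε⟩ : ∃ s, 0 ≤ s ∧ s < r ∧ r < s + ε / 2 :=
      ⟨max (r - ε / 4) 0, le_max_right _ _, max_lt (by linarith) hr,
        by linarith [le_max_left (r - ε / 4) 0]⟩
    obtain ⟨t, ht, hcov⟩ := Metric.totallyBounded_iff.1 (hs s hsr).totallyBounded (ε / 2)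
      (by positivity)
    refine ⟨t, ht, fun y hy => ?_⟩
    rw [Metric.mem_closedBall, dist_comm] at hy
    obtain ⟨z, hz, hzy⟩ := hX x y s (ε / 2) hs0 (by positivity) (by linarith)
    have hz' : z ∈ Metric.closedBall x s := by rwa [Metric.mem_closedBall, dist_comm]
    obtain ⟨p, hp, hzp⟩ := Set.mem_iUnion₂.1 (hcov hz')
    refine Set.mem_iUnion₂.2 ⟨p, hp, ?_⟩
    rw [Metric.mem_ball] at hzp ⊢
    rw [dist_comm] at hzy
    linarith [dist_triangle y z p]
  -- The infimum of the bad radii is itself good by `hlim`, and `hstep` then makes all radii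
  -- slightly beyond it good.
  by_contra hR
  set S : Set ℝ := {r | ¬ IsCompact (Metric.closedBall x r)} with hS
  have hmono : ∀ r s, r ≤ s → IsCompact (Metric.closedBall x s) →
      IsCompact (Metric.closedBall x r) := fun r s hrs hs =>
    hs.of_isClosed_subset Metric.isClosed_closedBall (Metric.closedBall_subset_closedBall hrs)
  have hlow : ∀ r ∈ S, 0 ≤ r := fun r hr => by
    by_contra! h0
    exact hr (by simp [Metric.closedBall_eq_empty.2 h0])
  have hbdd : BddBelow S := ⟨0, hlow⟩
  have hne : S.Nonempty := ⟨R, hR⟩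
  have h0 : 0 ≤ sInf S := le_csInf hne hlow
  have hc := hlim _ h0 fun s hs => by
    by_contra hcs
    exact absurd (csInf_le hbdd hcs) (not_le.2 hs)
  obtain ⟨δ, hδ, hcδ⟩ := hstep _ h0 hc
  obtain ⟨r, hr, hrδ⟩ := exists_lt_of_csInf_lt hne (lt_add_of_pos_right (sInf S) hδ)
  exact hr (hmono _ _ hrδ.le hcδ)

/-- Distances in a Riemannian manifold are approximately realised by intermediate points. -/
theorem exists_between_of_isRiemannianManifold
    {E : Type*} [NormedAddCommGroup E] [NormedSpace ℝ E]
    {H : Type*} [TopologicalSpace H] (I : ModelWithCorners ℝ E H)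
    {M : Type*} [MetricSpace M] [ChartedSpace H M] [IsManifold I ∞ M]
    [Bundle.RiemannianBundle (fun x : M => TangentSpace I x)]
    [IsRiemannianManifold I M] (x y : M) (r s : ℝ) (hr : 0 ≤ r) (hs : 0 < s)
    (hxy : dist x y < r + s) : ∃ z, dist x z ≤ r ∧ dist z y < s := by
  rcases le_or_gt (dist x y) r with hle | hlt
  · exact ⟨y, hle, by simpa⟩
  have he : Manifold.riemannianEDist I x y < ENNReal.ofReal (r + s) := by
    rw [← IsRiemannianManifold.out, edist_dist]
    exact (ENNReal.ofReal_lt_ofReal_iff (by linarith)).2 hxy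
  obtain ⟨γ, h0, h1, hγ, hlen⟩ := Manifold.exists_lt_of_riemannianEDist_lt he
  -- A nearly minimising curve crosses the sphere of radius `r` about `x`; the crossing point works
  -- because length is additive.
  have hcont : ContinuousOn (fun t => dist x (γ t)) (Set.Icc 0 1) :=
    continuous_dist.comp_continuousOn (continuousOn_const.prodMk hγ.continuousOn)
  obtain ⟨t, ht, htr⟩ := intermediate_value_Icc zero_le_one hcont
    (show r ∈ Set.Icc (dist x (γ 0)) (dist x (γ 1)) by simp [h0, h1, hr, hlt.le])
  refine ⟨γ t, htr.le, ?_⟩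
  have hl1 : edist x (γ t) ≤ Manifold.pathELength I γ 0 t := by
    rw [IsRiemannianManifold.out (I := I)]
    exact Manifold.riemannianEDist_le_pathELength
      (hγ.mono (Set.Icc_subset_Icc_right ht.2)) h0 rfl ht.1
  have hl2 : edist (γ t) y ≤ Manifold.pathELength I γ t 1 := by
    rw [IsRiemannianManifold.out (I := I)]
    exact Manifold.riemannianEDist_le_pathELength
      (hγ.mono (Set.Icc_subset_Icc_left ht.1)) rfl h1 ht.2
  have hsum : edist x (γ t) + edist (γ t) y < ENNReal.ofReal (r + s) :=
    (add_le_add hl1 hl2).trans_lt ((Manifold.pathELength_add ht.1 ht.2).trans_lt hlen)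
  rw [edist_dist, edist_dist, ← ENNReal.ofReal_add dist_nonneg dist_nonneg,
    ENNReal.ofReal_lt_ofReal_iff (by linarith)] at hsum
  simp only at htr
  linarith

/-- **Hopf–Rinow**: a complete finite-dimensional Riemannian manifold is a proper metric space. -/
theorem properSpace_of_isRiemannianManifold
    {E : Type*} [NormedAddCommGroup E] [NormedSpace ℝ E] [FiniteDimensional ℝ E]
    {H : Type*} [TopologicalSpace H] (I : ModelWithCorners ℝ E H)
    {M : Type*} [MetricSpace M] [ChartedSpace H M] [IsManifold I ∞ M]
    [Bundle.RiemannianBundle (fun x : M => TangentSpace I x)]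
    [IsRiemannianManifold I M] [CompleteSpace M] : ProperSpace M := by
  have : LocallyCompactSpace H := I.locallyCompactSpace
  have : LocallyCompactSpace M := ChartedSpace.locallyCompactSpace H M
  exact properSpace_of_exists_between (exists_between_of_isRiemannianManifold I)

/-! ### The cost profile and barycenters of points -/

section Profile

variable {h : ℝ → ℝ}

theorem IsCostProfile.continuousOn (hh : IsCostProfile h) : ContinuousOn h (Set.Ici 0) := by
  intro t ht
  rcases (Set.mem_Ici.1 ht).eq_or_lt with rfl | ht
  · rw [← continuousWithinAt_Ioi_iff_Ici, ContinuousWithinAt, hh.map_zero]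
    have h1 : Tendsto (fun t : ℝ => h t / t * t) (𝓝[>] 0) (𝓝 (0 * 0)) :=
      hh.tendsto_div.mul (tendsto_id.mono_left nhdsWithin_le_nhds)
    rw [zero_mul] at h1
    refine h1.congr' ?_
    filter_upwards [self_mem_nhdsWithin] with s hs
    exact div_mul_cancel₀ _ (ne_of_gt hs)
  · exact (hh.contDiffOn.continuousOn.continuousAt (Ioi_mem_nhds ht)).continuousWithinAt

theorem IsCostProfile.strictMonoOn (hh : IsCostProfile h) : StrictMonoOn h (Set.Ici 0) :=
  strictMonoOn_of_deriv_pos (convex_Ici 0) hh.continuousOn fun t ht => by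
    rw [interior_Ici] at ht
    exact hh.deriv_pos t ht

theorem IsCostProfile.nonneg (hh : IsCostProfile h) {t : ℝ} (ht : 0 ≤ t) : 0 ≤ h t := by
  simpa [hh.map_zero] using hh.strictMonoOn.monotoneOn (Set.mem_Ici.2 le_rfl) ht ht

theorem IsCostProfile.continuous_comp_dist (hh : IsCostProfile h) {X : Type*} [MetricSpace X] :
    Continuous fun p : X × X => h (dist p.1 p.2) :=
  hh.continuousOn.comp_continuous continuous_dist fun _ => dist_nonneg

end Profile

section Points

variable {X : Type*} [MetricSpace X] {n : ℕ} {h : ℝ → ℝ} {w : Fin n → ℝ}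

theorem pointObjective_nonneg (hh : IsCostProfile h) (hw : ∀ i, 0 ≤ w i) (x : Fin n → X) (y : X) :
    0 ≤ pointObjective h w x y :=
  Finset.sum_nonneg fun i _ => mul_nonneg (hw i) (hh.nonneg dist_nonneg)

theorem continuous_pointObjective (hh : IsCostProfile h) :
    Continuous fun p : X × (Fin n → X) => pointObjective h w p.2 p.1 := by
  unfold pointObjective
  refine continuous_finsetSum _ fun i _ => continuous_const.mul ?_
  exact hh.continuous_comp_dist.comp
    (continuous_fst.prodMk ((continuous_apply i).comp continuous_snd))

theorem multiCost_le_pointObjective (hh : IsCostProfile h) (hw : ∀ i, 0 ≤ w i) (x : Fin n → X)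
    (y : X) : multiCost h w x ≤ pointObjective h w x y :=
  ciInf_le ⟨0, Set.forall_mem_range.2 (pointObjective_nonneg hh hw x)⟩ y

theorem IsPointBarycenter.multiCost_eq (hh : IsCostProfile h) (hw : ∀ i, 0 ≤ w i) {x : Fin n → X}
    {z : X} (hz : IsPointBarycenter h w x z) : multiCost h w x = pointObjective h w x z :=
  haveI : Nonempty X := ⟨z⟩
  le_antisymm (multiCost_le_pointObjective hh hw x z) (le_ciInf hz)

/-- Barycenters of points of a bounded set stay within a bounded distance of that set. -/
theorem IsPointBarycenter.exists_dist_le (hh : IsCostProfile h) (hw : ∀ i, 0 < w i)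
    (hsum : ∑ i, w i = 1) {x : Fin n → X} {z : X} (hz : IsPointBarycenter h w x z) {D : ℝ}
    (hD0 : 0 ≤ D) (hD : ∀ i j, dist (x i) (x j) ≤ D) : ∃ i, dist z (x i) ≤ D := by
  by_contra! hlt
  have hne : (Finset.univ : Finset (Fin n)).Nonempty := by
    by_contra he
    rw [Finset.not_nonempty_iff_eq_empty] at he
    simp [he] at hsum
  obtain ⟨i₀, -⟩ := hne
  -- The competitor `x i₀` costs at most `h D`, whereas a point farther than `D` from every `x i`
  -- costs strictly more.
  have h1 : pointObjective h w x (x i₀) ≤ ∑ i, w i * h D :=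
    Finset.sum_le_sum fun i _ => mul_le_mul_of_nonneg_left
      (hh.strictMonoOn.monotoneOn (Set.mem_Ici.2 dist_nonneg) hD0 (hD i₀ i)) (hw i).le
  have h2 : ∑ i, w i * h D < pointObjective h w x z :=
    Finset.sum_lt_sum_of_nonempty ⟨i₀, Finset.mem_univ _⟩ fun i _ => mul_lt_mul_of_pos_left
      (hh.strictMonoOn hD0 (Set.mem_Ici.2 dist_nonneg) (hlt i)) (hw i)
  exact absurd (hz (x i₀)) (not_le.2 (h1.trans_lt h2))

end Points

/-! ### Gluing and stability of transport plans -/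

/-- **Gluing**: probability measures on `X × Y` with a common first marginal are the
two-dimensional marginals of a single probability measure on `X × (ι → Y)`. -/
theorem exists_gluing {X Y ι : Type*} [MeasurableSpace X] [MeasurableSpace Y]
    [StandardBorelSpace Y] [Nonempty Y] (ν : Measure X) [IsProbabilityMeasure ν]
    (ρ : ι → Measure (X × Y)) [∀ i, IsProbabilityMeasure (ρ i)]
    (hρ : ∀ i, (ρ i).map Prod.fst = ν) :
    ∃ γ : Measure (X × (ι → Y)), IsProbabilityMeasure γ ∧
      ∀ i, γ.map (fun p => (p.1, p.2 i)) = ρ i := by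
  -- Each conditional law is realised as the image of a uniform variable on `[0, 1]`. One variable
  -- serves all `i`, since the joint law of the coordinates is unconstrained.
  choose f hf hfκ using fun i =>
    ProbabilityTheory.Kernel.exists_measurable_map_eq_unitInterval (ρ i).condKernel
  have hF : Measurable fun p : X × unitInterval => (p.1, fun i => f i p.1 p.2) :=
    measurable_fst.prodMk (measurable_pi_lambda _ fun i => hf i)
  refine ⟨(ν.prod volume).map fun p => (p.1, fun i => f i p.1 p.2),
    Measure.isProbabilityMeasure_map hF.aemeasurable, fun i => ?_⟩
  have hG : Measurable fun p : X × (ι → Y) => (p.1, p.2 i) := by fun_prop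
  rw [Measure.map_map hG hF]
  conv_rhs => rw [← (ρ i).disintegrate (ρ i).condKernel]
  rw [show (ρ i).fst = ν from hρ i]
  ext s hs
  have hfi : Measurable (f i).uncurry := hf i
  rw [Measure.map_apply (hG.comp hF) hs, Measure.prod_apply (hG.comp hF hs),
    Measure.compProd_apply hs]
  refine lintegral_congr fun x => ?_
  have hfx : Measurable (f i x) := hfi.comp measurable_prodMk_left
  rw [← hfκ i x, Measure.map_apply hfx (measurable_prodMk_left hs)]
  rfl

/-- A transport plan `γ` from `ν` to `μ` induces a transport plan from `ν` to `μ'`, where the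
masses of the cells of a partition of unity under `μ` and `μ'` almost agree. -/
theorem exists_plan_of_partition {X Y ι : Type*} [Fintype ι] [MeasurableSpace X]
    [MeasurableSpace Y] (ν : Measure X) (μ μ' : Measure Y) [IsProbabilityMeasure ν]
    [IsProbabilityMeasure μ] [IsProbabilityMeasure μ'] (γ : Measure (X × Y))
    [IsProbabilityMeasure γ] (hγ₁ : γ.map Prod.fst = ν) (hγ₂ : γ.map Prod.snd = μ)
    {A : Set X} {L : Set Y} (hν : ∀ᵐ x ∂ν, x ∈ A) (hμ : ∀ᵐ y ∂μ, y ∈ L) (hμ' : ∀ᵐ y ∂μ', y ∈ L)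
    (φ : ι → Y → ENNReal) (hφ : ∀ k, Measurable (φ k)) (hφ1 : ∀ y ∈ L, ∑ k, φ k y = 1)
    (t : ENNReal) (ht0 : t ≠ 0) (ht1 : t ≤ 1) (ht : ∀ k, t * ∫⁻ y, φ k y ∂μ ≤ ∫⁻ y, φ k y ∂μ')
    (f : X × Y → ENNReal) (hf : Measurable f) (ε R : ENNReal)
    (hε : ∀ x ∈ A, ∀ y ∈ L, ∀ y' ∈ L, ∀ k, φ k y ≠ 0 → φ k y' ≠ 0 → f (x, y') ≤ f (x, y) + ε)
    (hR : ∀ x ∈ A, ∀ y ∈ L, f (x, y) ≤ R) :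
    ∃ γ' : Measure (X × Y), γ'.map Prod.fst = ν ∧ γ'.map Prod.snd = μ' ∧
      ∫⁻ p, f p ∂γ' ≤ ∫⁻ p, f p ∂γ + ε + (1 - t) * R := by
  have hγL : ∀ᵐ p ∂γ, p.2 ∈ L := ae_of_ae_map measurable_snd.aemeasurable (by rwa [hγ₂])
  have hγA : ∀ᵐ p ∂γ, p.1 ∈ A := ae_of_ae_map measurable_fst.aemeasurable (by rwa [hγ₁])
  set a : ι → ENNReal := fun k => ∫⁻ y, φ k y ∂μ with ha
  set b : ι → ENNReal := fun k => ∫⁻ y, φ k y ∂μ' with hb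
  have hb1 : ∀ k, b k ≠ ⊤ := fun k => by
    refine ne_top_of_le_ne_top ENNReal.one_ne_top ?_
    calc b k ≤ ∫⁻ _, 1 ∂μ' := lintegral_mono_ae (by
          filter_upwards [hμ'] with y hy
          rw [← hφ1 y hy]
          exact Finset.single_le_sum (f := fun k => φ k y) (fun _ _ => zero_le) (Finset.mem_univ k))
      _ = 1 := by simp
  have hφs : ∀ k, Measurable fun p : X × Y => φ k p.2 := fun k => (hφ k).comp measurable_snd
  -- In each cell `k`, the mass that `γ` sends there is redistributed according to `μ'` normalised
  -- on the cell (`G k`). Only the fraction `t` is moved so; `N` is the unused part of `μ'`, filled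
  -- by the product `ν.prod N`. The hypothesis `ht` gives `ρ ≤ 1` on `L`, so the subtraction is not
  -- truncated there.
  set F : ι → Measure X := fun k => (γ.withDensity fun p => φ k p.2).map Prod.fst with hF
  set G : ι → Measure Y := fun k => (b k)⁻¹ • μ'.withDensity (φ k) with hG
  set ρ : Y → ENNReal := fun y => ∑ k, t * a k * (b k)⁻¹ * φ k y with hρ
  have hρm : Measurable ρ := Finset.measurable_fun_sum _ fun k _ => (hφ k).const_mul _
  set N : Measure Y := μ'.withDensity fun y => 1 - ρ y with hN
  have hFu : ∀ k, F k Set.univ = a k := fun k => by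
    rw [hF, Measure.map_apply measurable_fst MeasurableSet.univ, Set.preimage_univ,
      withDensity_apply _ MeasurableSet.univ, Measure.restrict_univ, ha]
    simp only
    rw [← hγ₂, lintegral_map (hφ k) measurable_snd]
  have hGu' : ∀ k, G k Set.univ = (b k)⁻¹ * b k := fun k => by
    simp [hG, hb, withDensity_apply]
  have hGu : ∀ k, G k Set.univ ≤ 1 := fun k => by
    rw [hGu']
    exact ENNReal.inv_mul_le_one _
  have hρ1 : ∀ y ∈ L, ρ y ≤ 1 := fun y hy => by
    rw [← hφ1 y hy]
    refine Finset.sum_le_sum fun k _ => mul_le_of_le_one_left' ?_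
    exact (mul_le_mul_left (ht k) _).trans (by rw [mul_comm]; exact ENNReal.inv_mul_le_one _)
  have hGfin : ∀ k, IsFiniteMeasure (G k) := fun k => ⟨(hGu k).trans_lt ENNReal.one_lt_top⟩
  have hFfin : ∀ k, IsFiniteMeasure (F k) := fun k => ⟨by
    rw [hFu]
    refine lt_of_le_of_ne le_top fun htop => ?_
    have := ht k
    change t * a k ≤ b k at this
    rw [htop, ENNReal.mul_top ht0, top_le_iff] at this
    exact hb1 k this⟩
  have hNfin : IsFiniteMeasure N := by
    refine isFiniteMeasure_withDensity (ne_top_of_le_ne_top ENNReal.one_ne_top ?_)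
    calc ∫⁻ y, (1 - ρ y) ∂μ' ≤ ∫⁻ _, 1 ∂μ' := lintegral_mono fun y => tsub_le_self
      _ = 1 := by simp
  set γ' : Measure (X × Y) := t • ∑ k, (F k).prod (G k) + ν.prod N with hγ'
  -- If `b k = 0`, then `G k` is not normalised, but `ht` forces `a k = 0` and the cell contributes
  -- nothing.
  have hFG : ∀ k, G k Set.univ • F k = F k := fun k => by
    by_cases hbk : b k = 0
    · have hak : a k = 0 := by
        have := ht k
        change t * a k ≤ b k at this
        rw [hbk, nonpos_iff_eq_zero, mul_eq_zero] at this
        exact this.resolve_left ht0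
      have : F k = 0 := by rw [← Measure.measure_univ_eq_zero, hFu, hak]
      rw [this, smul_zero]
    · rw [hGu', ENNReal.inv_mul_cancel hbk (hb1 k), one_smul]
  have hFsum : ∑ k, F k = ν := by
    ext s hs
    rw [← hγ₁, Measure.map_apply measurable_fst hs, Measure.finsetSum_apply]
    simp_rw [hF, Measure.map_apply measurable_fst hs, withDensity_apply _ (measurable_fst hs)]
    rw [← lintegral_finsetSum _ fun k _ => hφs k, ← setLIntegral_one]
    refine lintegral_congr_ae (ae_restrict_of_ae ?_)
    filter_upwards [hγL] with p hp using hφ1 _ hp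
  have hsnd : γ'.map Prod.snd = μ' := by
    ext s hs
    have h1 : ∀ k, (F k).prod (G k) (Prod.snd ⁻¹' s) =
        ∫⁻ y in s, a k * (b k)⁻¹ * φ k y ∂μ' := fun k => by
      rw [← Set.univ_prod, Measure.prod_prod, hFu, lintegral_const_mul _ (hφ k)]
      simp [hG, withDensity_apply _ hs, mul_assoc]
    rw [Measure.map_apply measurable_snd hs, hγ', Measure.add_apply, Measure.smul_apply,
      Measure.finsetSum_apply, ← Set.univ_prod, Measure.prod_prod, measure_univ, one_mul,
      Set.univ_prod, Finset.sum_congr rfl fun k _ => h1 k,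
      ← lintegral_finsetSum _ fun k _ => (hφ k).const_mul _, smul_eq_mul,
      ← lintegral_const_mul _ (Finset.measurable_fun_sum _ fun k _ => (hφ k).const_mul _), hN,
      withDensity_apply _ hs, ← lintegral_add_right _ (hρm.const_sub 1), ← setLIntegral_one]
    refine lintegral_congr_ae (ae_restrict_of_ae ?_)
    filter_upwards [hμ'] with y hy
    rw [Finset.mul_sum]
    simp_rw [← mul_assoc]
    exact add_tsub_cancel_of_le (hρ1 y hy)
  have hfst' : γ'.map Prod.fst = (t + N Set.univ) • ν := by
    rw [hγ', Measure.map_add _ _ measurable_fst, Measure.map_smul, Measure.map_fst_prod, add_smul]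
    congr 2
    rw [← Measure.mapₗ_apply_of_measurable measurable_fst, map_sum]
    simp_rw [Measure.mapₗ_apply_of_measurable measurable_fst, Measure.map_fst_prod, hFG]
    exact hFsum
  -- The total mass of `γ'`, read from both marginals, determines that of `N`.
  have htN : t + N Set.univ = 1 := by
    have h1 : γ' Set.univ = 1 := by
      rw [← Set.preimage_univ (f := Prod.snd), ← Measure.map_apply measurable_snd .univ, hsnd,
        measure_univ]
    rw [← h1, ← Set.preimage_univ (f := Prod.fst), ← Measure.map_apply measurable_fst .univ, hfst']
    simp
  have hNu : N Set.univ = 1 - t := by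
    rw [← htN, ENNReal.add_sub_cancel_left (ne_top_of_le_ne_top ENNReal.one_ne_top ht1)]
  refine ⟨γ', by rw [hfst', htN, one_smul], hsnd, ?_⟩
  have hinner : ∀ k, Measurable fun x => ∫⁻ y, f (x, y) ∂(G k) := fun k =>
    hf.lintegral_prod_right'
  have hinner' : ∀ k, Measurable fun p : X × Y => ∫⁻ y, f (p.1, y) ∂(G k) := fun k =>
    (hinner k).comp measurable_fst
  -- Moving the target within one cell raises the cost by at most `ε`.
  have hcell : ∀ k, ∫⁻ p, f p ∂((F k).prod (G k)) ≤ ∫⁻ p, φ k p.2 * (f p + ε) ∂γ := fun k => by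
    rw [lintegral_prod _ hf.aemeasurable, hF, lintegral_map (hinner k) measurable_fst,
      lintegral_withDensity_eq_lintegral_mul _ (hφs k) (hinner' k)]
    refine lintegral_mono_ae ?_
    filter_upwards [hγL, hγA] with p hpL hpA
    by_cases hk : φ k p.2 = 0
    · simp [hk]
    refine mul_le_mul_right ?_ _
    calc ∫⁻ y, f (p.1, y) ∂(G k) ≤ ∫⁻ _, (f p + ε) ∂(G k) := lintegral_mono_ae ?_
      _ = (f p + ε) * G k Set.univ := lintegral_const _
      _ ≤ f p + ε := mul_le_of_le_one_right' (hGu k)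
    refine Measure.ae_smul_measure ?_ _
    rw [ae_withDensity_iff (hφ k)]
    filter_upwards [hμ'] with y hy hky using hε _ hpA _ hpL _ hy k hk hky
  have hrest : ∫⁻ p, f p ∂(ν.prod N) ≤ (1 - t) * R := by
    rw [lintegral_prod _ hf.aemeasurable]
    calc ∫⁻ x, ∫⁻ y, f (x, y) ∂N ∂ν ≤ ∫⁻ _, ∫⁻ _, R ∂N ∂ν := by
          refine lintegral_mono_ae ?_
          filter_upwards [hν] with x hx
          refine lintegral_mono_ae ?_
          filter_upwards [(withDensity_absolutelyContinuous μ' _).ae_le hμ'] with y hy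
            using hR x hx y hy
      _ = (1 - t) * R := by simp [hNu, mul_comm]
  rw [hγ', lintegral_add_measure, lintegral_smul_measure, lintegral_finsetSum_measure]
  refine add_le_add ((mul_le_of_le_one_left' ht1).trans ?_) hrest
  calc ∑ k, ∫⁻ p, f p ∂((F k).prod (G k)) ≤ ∑ k, ∫⁻ p, φ k p.2 * (f p + ε) ∂γ :=
        Finset.sum_le_sum fun k _ => hcell k
    _ = ∫⁻ p, ∑ k, φ k p.2 * (f p + ε) ∂γ :=
        (lintegral_finsetSum _ fun k _ => (hφs k).mul (hf.add_const ε)).symm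
    _ = ∫⁻ p, (f p + ε) ∂γ := by
        refine lintegral_congr_ae ?_
        filter_upwards [hγL] with p hp
        rw [← Finset.sum_mul, hφ1 _ hp, one_mul]
    _ = ∫⁻ p, f p ∂γ + ε := by rw [lintegral_add_right _ measurable_const]; simp

/-- A compact set in a metric space admits finite continuous partitions of unity subordinate to
arbitrarily small balls. -/
theorem exists_finite_partition {X : Type*} [MetricSpace X] {L : Set X} (hL : IsCompact L)
    {r : ℝ} (hr : 0 < r) :
    ∃ (t : Finset X) (φ : t → C(X, NNReal)), (∀ k x, φ k x ≤ 1) ∧ (∀ x ∈ L, ∑ k, φ k x = 1) ∧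
      ∀ k x y, φ k x ≠ 0 → φ k y ≠ 0 → dist x y < r := by
  obtain ⟨t, htL, htf, hcov⟩ := hL.finite_cover_balls (half_pos hr)
  lift t to Finset X using htf
  obtain ⟨φ, hφ⟩ := PartitionOfUnity.exists_isSubordinate hL.isClosed
    (fun k : t => Metric.ball (k : X) (r / 2)) (fun _ => Metric.isOpen_ball)
    (fun x hx => by simpa using hcov hx)
  refine ⟨t, fun k => ⟨fun x => (φ k x).toNNReal,
    continuous_real_toNNReal.comp (φ k).continuous⟩, ?_, ?_, ?_⟩
  · intro k x
    simpa using φ.le_one k x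
  · intro x hx
    have h1 := φ.sum_eq_one hx
    rw [finsum_eq_sum_of_fintype] at h1
    simp only [ContinuousMap.coe_mk]
    rw [← Real.toNNReal_sum_of_nonneg fun k _ => φ.nonneg k x, h1, Real.toNNReal_one]
  · intro k x y hx hy
    have hmem : ∀ z, (φ k z).toNNReal ≠ 0 → z ∈ Metric.ball (k : X) (r / 2) := fun z hz =>
      hφ k (subset_tsupport _ fun h0 => hz (by rw [h0, Real.toNNReal_zero]))
    have h1 := Metric.mem_ball.1 (hmem x hx)
    have h2 := Metric.mem_ball'.1 (hmem y hy)
    linarith [dist_triangle x k y]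

/-- Transport plans are stable under weak convergence of the second marginal: on a compact set, a
plan from `ν` to `μ` is approximated in cost by plans from `ν` to `μs j`. -/
theorem eventually_exists_plan_lintegral_le {X : Type*} [MetricSpace X] [MeasurableSpace X]
    [BorelSpace X] [SecondCountableTopology X] {L : Set X} (hL : IsCompact L)
    {ν μ : ProbabilityMeasure X} {μs : ℕ → ProbabilityMeasure X}
    (hμs : Tendsto μs atTop (𝓝 μ)) (hν : ∀ᵐ x ∂(ν : Measure X), x ∈ L)
    (hμL : ∀ᵐ x ∂(μ : Measure X), x ∈ L) (hμsL : ∀ j, ∀ᵐ x ∂(μs j : Measure X), x ∈ L)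
    {c : X × X → ℝ} (hc : Continuous c) {γ : ProbabilityMeasure (X × X)} (hγ : γ ∈ plans ν μ)
    {ε : ℝ} (hε : 0 < ε) :
    ∀ᶠ j in atTop, ∃ γ' ∈ plans ν (μs j), ∫⁻ p, ENNReal.ofReal (c p) ∂(γ' : Measure (X × X)) ≤
      ∫⁻ p, ENNReal.ofReal (c p) ∂(γ : Measure (X × X)) + ENNReal.ofReal ε := by
  have hLL : IsCompact (L ×ˢ L) := hL.prod hL
  obtain ⟨R, hR0, hR⟩ : ∃ R : ℝ, 0 < R ∧ ∀ p ∈ L ×ˢ L, c p ≤ R := by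
    obtain ⟨R, hR⟩ := (hLL.image hc).bddAbove
    exact ⟨max R 1, by positivity, fun p hp =>
      (hR (Set.mem_image_of_mem c hp)).trans (le_max_left _ _)⟩
  obtain ⟨r, hr, hcr⟩ := Metric.uniformContinuousOn_iff.1
    (hLL.uniformContinuousOn_of_continuous hc.continuousOn) (ε / 2) (half_pos hε)
  obtain ⟨s, φ, hφ1, hφsum, hφr⟩ := exists_finite_partition hL hr
  -- Half of `ε` pays for moves within cells, the other half for the leftover mass `δ` at cost at
  -- most `R`.
  obtain ⟨δ, hδ0, hδ1, hδR⟩ : ∃ δ : ℝ, 0 < δ ∧ δ < 1 ∧ δ * R ≤ ε / 2 := by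
    refine ⟨min (1 / 2) (ε / 2 / R), by positivity, (min_le_left _ _).trans_lt (by norm_num), ?_⟩
    calc min (1 / 2) (ε / 2 / R) * R ≤ ε / 2 / R * R := by gcongr; exact min_le_right _ _
      _ = ε / 2 := by field_simp
  set t : ENNReal := ENNReal.ofReal (1 - δ) with ht
  have ht1 : t < 1 := by
    rw [ht, ← ENNReal.ofReal_one]
    exact (ENNReal.ofReal_lt_ofReal_iff one_pos).2 (by linarith)
  have ht0 : t ≠ 0 := by
    rw [ht, Ne, ENNReal.ofReal_eq_zero]
    linarith
  have hmass : ∀ᶠ j in atTop, ∀ k, t * ∫⁻ y, (φ k y : ENNReal) ∂(μ : Measure X) ≤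
      ∫⁻ y, (φ k y : ENNReal) ∂(μs j : Measure X) := by
    refine eventually_all.2 fun k => ?_
    have hlim := ProbabilityMeasure.tendsto_iff_forall_lintegral_tendsto.1 hμs
      (BoundedContinuousFunction.mkOfBound (φ k) 1 fun x y => by
        rw [NNReal.dist_eq, abs_le]
        have h1 : (φ k x : ℝ) ≤ 1 := hφ1 k x
        have h2 : (φ k y : ℝ) ≤ 1 := hφ1 k y
        constructor <;> linarith [(φ k x).2, (φ k y).2])
    simp only [BoundedContinuousFunction.mkOfBound_coe] at hlim
    set a := ∫⁻ y, (φ k y : ENNReal) ∂(μ : Measure X) with ha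
    by_cases ha0 : a = 0
    · simp [ha0]
    have ha1 : a ≠ ⊤ := by
      refine ne_top_of_le_ne_top ENNReal.one_ne_top ?_
      calc a ≤ ∫⁻ _, 1 ∂(μ : Measure X) :=
            lintegral_mono fun y => ENNReal.coe_le_one_iff.2 (hφ1 k y)
        _ = 1 := by simp
    -- The strict gap `t < 1` absorbs the error in the convergence of the cell masses.
    have hlt : t * a < a := by
      conv_rhs => rw [← one_mul a]
      exact ENNReal.mul_lt_mul_left ha0 ha1 ht1
    exact (hlim.eventually (lt_mem_nhds hlt)).mono fun j hj => hj.le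
  filter_upwards [hmass] with j hj
  obtain ⟨γ', h1, h2, h3⟩ := exists_plan_of_partition (ν : Measure X) (μ : Measure X)
    (μs j : Measure X) (γ : Measure (X × X)) hγ.1 hγ.2 hν hμL (hμsL j)
    (fun k y => (φ k y : ENNReal)) (fun k => (φ k).continuous.measurable.coe_nnreal_ennreal)
    (fun y hy => by exact_mod_cast hφsum y hy) t ht0 ht1.le hj
    (fun p => ENNReal.ofReal (c p)) hc.measurable.ennreal_ofReal
    (ENNReal.ofReal (ε / 2)) (ENNReal.ofReal R)
    (fun x hx y hy y' hy' k hk hk' => by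
      have hd := hcr (x, y') ⟨hx, hy'⟩ (x, y) ⟨hx, hy⟩ (by
        rw [Prod.dist_eq, dist_self, max_eq_right dist_nonneg]
        exact hφr k _ _ (by exact_mod_cast hk') (by exact_mod_cast hk))
      rw [Real.dist_eq] at hd
      refine (ENNReal.ofReal_le_ofReal ?_).trans ENNReal.ofReal_add_le
      linarith [(abs_lt.1 hd).2])
    (fun x hx y hy => ENNReal.ofReal_le_ofReal (hR _ ⟨hx, hy⟩))
  have hprob : IsProbabilityMeasure γ' := ⟨by
    rw [← Set.preimage_univ (f := Prod.fst), ← Measure.map_apply measurable_fst .univ, h1,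
      measure_univ]⟩
  refine ⟨⟨γ', hprob⟩, ⟨h1, h2⟩, h3.trans ?_⟩
  rw [add_assoc]
  gcongr
  have h1t : (1 : ENNReal) - t = ENNReal.ofReal δ := by
    rw [ht, ← ENNReal.ofReal_one, ← ENNReal.ofReal_sub _ (by linarith)]
    congr 1
    ring
  rw [h1t, ← ENNReal.ofReal_mul hδ0.le, ← ENNReal.ofReal_add (by positivity) (by positivity)]
  exact ENNReal.ofReal_le_ofReal (by linarith)

/-! ### Multi-marginal plans and the barycenter functional -/

section Plans

variable {X : Type*} [MeasurableSpace X] {n : ℕ}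

theorem measurable_prodMk_eval (i : Fin n) :
    Measurable fun p : X × (Fin n → X) => (p.1, p.2 i) := by fun_prop

/-- The law of `(B x, x)` when `x` has law `γ`. -/
noncomputable def selectionPlan {B : (Fin n → X) → X} (hB : Measurable B)
    (γ : ProbabilityMeasure (Fin n → X)) : ProbabilityMeasure (X × (Fin n → X)) :=
  γ.map (hB.prodMk measurable_id).aemeasurable

theorem coe_selectionPlan {B : (Fin n → X) → X} (hB : Measurable B)
    (γ : ProbabilityMeasure (Fin n → X)) :
    (selectionPlan hB γ : Measure (X × (Fin n → X))) =
      (γ : Measure (Fin n → X)).map fun x => (B x, x) := rfl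

theorem map_fst_selectionPlan {B : (Fin n → X) → X} (hB : Measurable B)
    (γ : ProbabilityMeasure (Fin n → X)) :
    (selectionPlan hB γ : Measure (X × (Fin n → X))).map Prod.fst =
      (γ : Measure (Fin n → X)).map B :=
  Measure.map_map measurable_fst (hB.prodMk measurable_id)

theorem map_eval_selectionPlan {B : (Fin n → X) → X} (hB : Measurable B)
    {μ : Fin n → ProbabilityMeasure X} {γ : ProbabilityMeasure (Fin n → X)}
    (hγ : γ ∈ multiPlans μ) (i : Fin n) :
    (selectionPlan hB γ : Measure (X × (Fin n → X))).map (fun p => p.2 i) = μ i := by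
  rw [← hγ i]
  exact Measure.map_map (by fun_prop) (hB.prodMk measurable_id)

theorem ae_forall_mem_of_mem_multiPlans {μ : Fin n → ProbabilityMeasure X}
    {γ : ProbabilityMeasure (Fin n → X)} (hγ : γ ∈ multiPlans μ) {K : Set X}
    (hμ : ∀ i, ∀ᵐ x ∂(μ i : Measure X), x ∈ K) :
    ∀ᵐ x ∂(γ : Measure (Fin n → X)), ∀ i, x i ∈ K :=
  ae_all_iff.2 fun i => ae_of_ae_map (measurable_pi_apply i).aemeasurable (by
    rw [hγ i]
    exact hμ i)

end Plans

theorem barycenterFunctional_le {X : Type*} [MetricSpace X] [MeasurableSpace X] {n : ℕ}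
    {h : ℝ → ℝ} {w : Fin n → ℝ} {μ : Fin n → ProbabilityMeasure X} {ν : ProbabilityMeasure X}
    {γ : Fin n → ProbabilityMeasure (X × X)} (hγ : ∀ i, γ i ∈ plans ν (μ i)) :
    barycenterFunctional h w μ ν ≤ ∑ i, ENNReal.ofReal (w i) *
      ∫⁻ p, ENNReal.ofReal (h (dist p.1 p.2)) ∂(γ i : Measure (X × X)) :=
  Finset.sum_le_sum fun i _ => mul_le_mul_right (iInf₂_le (γ i) (hγ i)) _

section Functional

variable {X : Type*} [MetricSpace X] [MeasurableSpace X] [BorelSpace X]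
  [SecondCountableTopology X] {n : ℕ} {h : ℝ → ℝ} {w : Fin n → ℝ}

theorem measurable_cost (hh : IsCostProfile h) :
    Measurable fun p : X × X => ENNReal.ofReal (h (dist p.1 p.2)) :=
  hh.continuous_comp_dist.measurable.ennreal_ofReal

/-- The integral of the objective is the weighted sum of the costs of the two-dimensional
marginals. -/
theorem lintegral_pointObjective (hh : IsCostProfile h) (hw : ∀ i, 0 ≤ w i)
    (η : Measure (X × (Fin n → X))) :
    ∫⁻ p, ENNReal.ofReal (pointObjective h w p.2 p.1) ∂η =
      ∑ i, ENNReal.ofReal (w i) *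
        ∫⁻ q, ENNReal.ofReal (h (dist q.1 q.2)) ∂(η.map fun p => (p.1, p.2 i)) := by
  simp_rw [lintegral_map (measurable_cost hh) (measurable_prodMk_eval _)]
  have hm : ∀ i, Measurable fun p : X × (Fin n → X) => ENNReal.ofReal (h (dist p.1 (p.2 i))) :=
    fun i => (measurable_cost hh).comp (measurable_prodMk_eval i)
  simp_rw [← fun i => lintegral_const_mul (ENNReal.ofReal (w i)) (hm i) (μ := η)]
  rw [← lintegral_finsetSum _ fun i _ => (hm i).const_mul _]
  refine lintegral_congr fun p => ?_
  rw [pointObjective, ENNReal.ofReal_sum_of_nonneg fun i _ =>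
    mul_nonneg (hw i) (hh.nonneg dist_nonneg)]
  exact Finset.sum_congr rfl fun i _ => ENNReal.ofReal_mul (hw i)

/-- A measure on `X × Xⁿ` bounds the barycenter functional at its marginals. -/
theorem barycenterFunctional_le_lintegral_pointObjective (hh : IsCostProfile h)
    (hw : ∀ i, 0 ≤ w i) {μ : Fin n → ProbabilityMeasure X} {ν : ProbabilityMeasure X}
    (η : ProbabilityMeasure (X × (Fin n → X)))
    (hη₁ : (η : Measure (X × (Fin n → X))).map Prod.fst = ν)
    (hη₂ : ∀ i, (η : Measure (X × (Fin n → X))).map (fun p => p.2 i) = μ i) :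
    barycenterFunctional h w μ ν ≤
      ∫⁻ p, ENNReal.ofReal (pointObjective h w p.2 p.1) ∂(η : Measure (X × (Fin n → X))) := by
  rw [lintegral_pointObjective hh hw]
  refine barycenterFunctional_le
    (γ := fun i => η.map (measurable_prodMk_eval i).aemeasurable) fun i => ⟨?_, ?_⟩
  · rw [ProbabilityMeasure.toMeasure_map, Measure.map_map measurable_fst (measurable_prodMk_eval i)]
    exact hη₁
  · rw [ProbabilityMeasure.toMeasure_map, Measure.map_map measurable_snd (measurable_prodMk_eval i)]
    exact hη₂ i

/-- If the weighted sum of transport costs at `ν` is finite then, up to `ε`, it is realised by a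
multi-marginal plan. -/
theorem exists_multiPlan_lintegral_multiCost_le [CompleteSpace X] (hh : IsCostProfile h)
    (hw : ∀ i, 0 < w i) (hsum : ∑ i, w i = 1) (μ : Fin n → ProbabilityMeasure X)
    (ν : ProbabilityMeasure X) {ε : NNReal} (hε : 0 < ε) :
    ∃ σ ∈ multiPlans μ, ∫⁻ x, ENNReal.ofReal (multiCost h w x) ∂(σ : Measure (Fin n → X)) ≤
      barycenterFunctional h w μ ν + ε := by
  have : Nonempty X := ν.nonempty
  have hex : ∀ i, ∃ γ ∈ plans ν (μ i),
      ∫⁻ p, ENNReal.ofReal (h (dist p.1 p.2)) ∂(γ : Measure (X × X)) ≤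
        transportCost h ν (μ i) + ε := fun i => by
    by_cases htop : transportCost h ν (μ i) = ⊤
    -- At infinite cost any plan will do.
    · refine ⟨ν.prod (μ i), ⟨?_, ?_⟩, by simp [htop]⟩ <;> simp
    · have hlt := ENNReal.lt_add_right htop (ENNReal.coe_ne_zero.2 hε.ne')
      conv_lhs at hlt => rw [transportCost]
      simp only [iInf_lt_iff] at hlt
      obtain ⟨γ, hγ, hle⟩ := hlt
      exact ⟨γ, hγ, hle.le⟩
  choose γ hγ hle using hex
  obtain ⟨η, hη, hηγ⟩ := exists_gluing (ν : Measure X) (fun i => (γ i : Measure (X × X)))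
    fun i => (hγ i).1
  refine ⟨⟨η.map Prod.snd, Measure.isProbabilityMeasure_map measurable_snd.aemeasurable⟩,
    fun i => ?_, ?_⟩
  · rw [ProbabilityMeasure.coe_mk, Measure.map_map (measurable_pi_apply i) measurable_snd,
      ← (hγ i).2, ← hηγ i, Measure.map_map measurable_snd (measurable_prodMk_eval i)]
    rfl
  · calc ∫⁻ x, ENNReal.ofReal (multiCost h w x) ∂(η.map Prod.snd)
        ≤ ∫⁻ p, ENNReal.ofReal (multiCost h w p.2) ∂η := lintegral_map_le _ _
      _ ≤ ∫⁻ p, ENNReal.ofReal (pointObjective h w p.2 p.1) ∂η := lintegral_mono fun p =>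
          ENNReal.ofReal_le_ofReal (multiCost_le_pointObjective hh (fun i => (hw i).le) _ _)
      _ = ∑ i, ENNReal.ofReal (w i) *
          ∫⁻ q, ENNReal.ofReal (h (dist q.1 q.2)) ∂(γ i : Measure (X × X)) := by
          rw [lintegral_pointObjective hh fun i => (hw i).le]
          simp_rw [hηγ]
      _ ≤ ∑ i, ENNReal.ofReal (w i) * (transportCost h ν (μ i) + ε) :=
          Finset.sum_le_sum fun i _ => mul_le_mul_right (hle i) _
      _ = barycenterFunctional h w μ ν + ε := by
          simp_rw [mul_add, Finset.sum_add_distrib]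
          rw [← Finset.sum_mul, ← ENNReal.ofReal_sum_of_nonneg fun i _ => (hw i).le, hsum]
          simp [barycenterFunctional]

/-- The multi-marginal optimal value is at most the barycenter functional. -/
theorem IsOptimalMultiPlan.lintegral_multiCost_le [CompleteSpace X] (hh : IsCostProfile h)
    (hw : ∀ i, 0 < w i) (hsum : ∑ i, w i = 1) {μ : Fin n → ProbabilityMeasure X}
    {γ : ProbabilityMeasure (Fin n → X)} (hγ : IsOptimalMultiPlan h w μ γ)
    (ν : ProbabilityMeasure X) :
    ∫⁻ x, ENNReal.ofReal (multiCost h w x) ∂(γ : Measure (Fin n → X)) ≤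
      barycenterFunctional h w μ ν := by
  refine ENNReal.le_of_forall_pos_le_add fun ε hε _ => ?_
  obtain ⟨σ, hσ, hle⟩ := exists_multiPlan_lintegral_multiCost_le hh hw hsum μ ν hε
  exact (hγ.2 hσ).trans hle

/-- A selection attains the infimum defining `C` pointwise; this links the upper bound on the
functional to the multi-marginal value. -/
theorem lintegral_pointObjective_selectionPlan (hh : IsCostProfile h) (hw : ∀ i, 0 ≤ w i)
    {B : (Fin n → X) → X} (hB : IsBarycenterSelection h w B)
    (γ : ProbabilityMeasure (Fin n → X)) :
    ∫⁻ p, ENNReal.ofReal (pointObjective h w p.2 p.1)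
        ∂(selectionPlan hB.1 γ : Measure (X × (Fin n → X))) =
      ∫⁻ x, ENNReal.ofReal (multiCost h w x) ∂(γ : Measure (Fin n → X)) := by
  rw [coe_selectionPlan, lintegral_map (continuous_pointObjective hh).measurable.ennreal_ofReal
    (hB.1.prodMk measurable_id')]
  exact lintegral_congr fun x => by rw [(hB.2 x).multiCost_eq hh hw]

/-- The transport costs from a fixed compactly supported measure are upper semicontinuous in the
target. -/
theorem eventually_barycenterFunctional_le {L : Set X} (hL : IsCompact L) (hh : IsCostProfile h)
    (hw : ∀ i, 0 < w i) (hsum : ∑ i, w i = 1) {μ : Fin n → ProbabilityMeasure X}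
    {μs : ℕ → Fin n → ProbabilityMeasure X} (hμs : ∀ i, Tendsto (fun j => μs j i) atTop (𝓝 (μ i)))
    (hμL : ∀ i, ∀ᵐ x ∂(μ i : Measure X), x ∈ L)
    (hμsL : ∀ j i, ∀ᵐ x ∂(μs j i : Measure X), x ∈ L)
    {ν : ProbabilityMeasure X} (hν : ∀ᵐ x ∂(ν : Measure X), x ∈ L)
    (η : ProbabilityMeasure (X × (Fin n → X)))
    (hη₁ : (η : Measure (X × (Fin n → X))).map Prod.fst = ν)
    (hη₂ : ∀ i, (η : Measure (X × (Fin n → X))).map (fun p => p.2 i) = μ i)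
    {ε : NNReal} (hε : 0 < ε) :
    ∀ᶠ j in atTop, barycenterFunctional h w (μs j) ν ≤
      ∫⁻ p, ENNReal.ofReal (pointObjective h w p.2 p.1) ∂(η : Measure (X × (Fin n → X))) + ε := by
  have hpl : ∀ i, η.map (measurable_prodMk_eval i).aemeasurable ∈ plans ν (μ i) := fun i => by
    refine ⟨?_, ?_⟩
    · rw [ProbabilityMeasure.toMeasure_map,
        Measure.map_map measurable_fst (measurable_prodMk_eval i)]
      exact hη₁
    · rw [ProbabilityMeasure.toMeasure_map,
        Measure.map_map measurable_snd (measurable_prodMk_eval i)]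
      exact hη₂ i
  have hev := eventually_all.2 fun i => eventually_exists_plan_lintegral_le hL (hμs i) hν (hμL i)
    (fun j => hμsL j i) hh.continuous_comp_dist (hpl i) (NNReal.coe_pos.2 hε)
  filter_upwards [hev] with j hj
  choose γ hγ hle using hj
  refine (barycenterFunctional_le hγ).trans ?_
  calc ∑ i, ENNReal.ofReal (w i) *
        ∫⁻ p, ENNReal.ofReal (h (dist p.1 p.2)) ∂(γ i : Measure (X × X))
      ≤ ∑ i, ENNReal.ofReal (w i) * (∫⁻ q, ENNReal.ofReal (h (dist q.1 q.2))
          ∂((η : Measure (X × (Fin n → X))).map fun p => (p.1, p.2 i)) + ENNReal.ofReal ε) :=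
        Finset.sum_le_sum fun i _ => mul_le_mul_right (hle i) _
    _ = _ := by
        simp_rw [mul_add, Finset.sum_add_distrib]
        rw [← Finset.sum_mul, ← ENNReal.ofReal_sum_of_nonneg fun i _ => (hw i).le, hsum,
          lintegral_pointObjective hh fun i => (hw i).le]
        simp

end Functional

/-! ### Compactness and passage to the limit -/

/-- Probability measures carried by a common compact set have a weakly convergent subsequence. -/
theorem exists_subseq_tendsto_of_forall_ae_mem {X : Type*} [MetricSpace X] [MeasurableSpace X]
    [BorelSpace X] [SecondCountableTopology X] {L : Set X} (hL : IsCompact L)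
    (η : ℕ → ProbabilityMeasure X) (hη : ∀ j, ∀ᵐ x ∂(η j : Measure X), x ∈ L) :
    ∃ (φ : ℕ → ℕ) (ηlim : ProbabilityMeasure X), StrictMono φ ∧
      Tendsto (fun k => η (φ k)) atTop (𝓝 ηlim) := by
  have hcomp : IsCompact (closure (Set.range η)) := by
    refine isCompact_closure_of_isTightMeasureSet
      (isTightMeasureSet_iff_exists_isCompact_measure_compl_le.2 fun ε _ => ⟨L, hL, ?_⟩)
    rintro _ ⟨_, ⟨j, rfl⟩, rfl⟩
    exact (show (η j : Measure X) Lᶜ = 0 from hη j).le.trans zero_le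
  obtain ⟨ηlim, -, φ, hφ, hlim⟩ := hcomp.tendsto_subseq fun j => subset_closure ⟨j, rfl⟩
  exact ⟨φ, ηlim, hφ, hlim⟩

/-- A weak limit of probability measures carried by a closed set is carried by that set. -/
theorem ae_mem_of_tendsto {X : Type*} [MetricSpace X] [MeasurableSpace X] [BorelSpace X]
    {L : Set X} (hL : IsClosed L) {ν : ℕ → ProbabilityMeasure X} {νlim : ProbabilityMeasure X}
    (hlim : Tendsto ν atTop (𝓝 νlim)) (hν : ∀ j, ∀ᵐ x ∂(ν j : Measure X), x ∈ L) :
    ∀ᵐ x ∂(νlim : Measure X), x ∈ L := by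
  have h1 := ProbabilityMeasure.limsup_measure_closed_le_of_tendsto hlim hL
  have h2 : ∀ j, (ν j : Measure X) L = 1 := fun j => (mem_ae_iff_prob_eq_one hL.measurableSet).1 (hν j)
  simp only [h2, limsup_const] at h1
  exact (mem_ae_iff_prob_eq_one hL.measurableSet).2 (le_antisymm prob_le_one h1)

theorem mem_finiteMoment_of_ae_mem {X : Type*} [MetricSpace X] [MeasurableSpace X]
    {h : ℝ → ℝ} (hh : IsCostProfile h) {L : Set X} (hL : IsCompact L) {ν : ProbabilityMeasure X}
    (hν : ∀ᵐ x ∂(ν : Measure X), x ∈ L) : ν ∈ finiteMoment h := by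
  obtain ⟨x₀⟩ := ν.nonempty
  have hc : Continuous fun x => h (dist x₀ x) :=
    hh.continuous_comp_dist.comp (continuous_const.prodMk continuous_id)
  obtain ⟨R, hR⟩ := (hL.image hc).bddAbove
  refine ⟨x₀, ?_⟩
  calc ∫⁻ x, ENNReal.ofReal (h (dist x₀ x)) ∂(ν : Measure X)
      ≤ ∫⁻ _, ENNReal.ofReal R ∂(ν : Measure X) := lintegral_mono_ae (by
        filter_upwards [hν] with x hx
        exact ENNReal.ofReal_le_ofReal (hR (Set.mem_image_of_mem _ hx)))
    _ < ⊤ := by simp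

/-- Barycenters of points of a compact set remain in a compact set. -/
theorem exists_isCompact_forall_selection_mem {X : Type*} [MetricSpace X] [ProperSpace X] {n : ℕ}
    {h : ℝ → ℝ} {w : Fin n → ℝ} (hh : IsCostProfile h) (hw : ∀ i, 0 < w i)
    (hsum : ∑ i, w i = 1) {K : Set X} (hK : IsCompact K) :
    ∃ L, IsCompact L ∧ K ⊆ L ∧ ∀ (x : Fin n → X) (z : X), (∀ i, x i ∈ K) →
      IsPointBarycenter h w x z → z ∈ L := by
  refine ⟨Metric.cthickening (Metric.diam K) K, hK.cthickening,
    Metric.self_subset_cthickening K, fun x z hx hz => ?_⟩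
  obtain ⟨i, hi⟩ := hz.exists_dist_le hh hw hsum Metric.diam_nonneg fun i j =>
    Metric.dist_le_diam_of_mem hK.isBounded (hx i) (hx j)
  exact Metric.mem_cthickening_of_dist_le z (x i) _ _ (hx i) hi

/-- Consistency of constructed barycenters in a proper metric space. -/
theorem exists_subseq_tendsto_isWassersteinBarycenter {X : Type*} [MetricSpace X] [ProperSpace X]
    [MeasurableSpace X] [BorelSpace X] {n : ℕ} {h : ℝ → ℝ} {w : Fin n → ℝ}
    (hh : IsCostProfile h) (hw : ∀ i, 0 < w i) (hsum : ∑ i, w i = 1)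
    {μ : Fin n → ProbabilityMeasure X} {μs : ℕ → Fin n → ProbabilityMeasure X}
    (hμs : ∀ i, Tendsto (fun j => μs j i) atTop (𝓝 (μ i))) {K : Set X} (hK : IsCompact K)
    (hμK : ∀ i, ∀ᵐ x ∂(μ i : Measure X), x ∈ K)
    (hμsK : ∀ j i, ∀ᵐ x ∂(μs j i : Measure X), x ∈ K)
    {ν : ℕ → ProbabilityMeasure X} (hν : ∀ j, IsConstructedBarycenter h w (μs j) (ν j)) :
    ∃ φ : ℕ → ℕ, StrictMono φ ∧ ∃ νlim : ProbabilityMeasure X,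
      IsWassersteinBarycenter h w μ νlim ∧ Tendsto (fun k => ν (φ k)) atTop (𝓝 νlim) := by
  have hw0 : ∀ i, 0 ≤ w i := fun i => (hw i).le
  obtain ⟨L, hL, hKL, hbar⟩ := exists_isCompact_forall_selection_mem hh hw hsum hK
  choose γ B hγ hB hνB using hν
  -- Stated for arbitrary marginals and plans, as it serves both the sequence `η` and the competitor
  -- `ξ`.
  have hsel : ∀ {m : Fin n → ProbabilityMeasure X} {σ : ProbabilityMeasure (Fin n → X)}
      (_ : σ ∈ multiPlans m) (_ : ∀ i, ∀ᵐ x ∂(m i : Measure X), x ∈ K) (j : ℕ),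
      ∀ᵐ p ∂(selectionPlan (hB j).1 σ : Measure (X × (Fin n → X))),
        p ∈ L ×ˢ Set.univ.pi fun _ : Fin n => K := by
    intro m σ hσ hm j
    rw [coe_selectionPlan]
    have hcl : IsClosed (L ×ˢ Set.univ.pi fun _ : Fin n => K) :=
      hL.isClosed.prod (isClosed_set_pi fun _ _ => hK.isClosed)
    refine (ae_map_iff ((hB j).1.prodMk measurable_id').aemeasurable hcl.measurableSet).2 ?_
    filter_upwards [ae_forall_mem_of_mem_multiPlans hσ hm] with x hx
    exact ⟨hbar x _ hx ((hB j).2 x), fun i _ => hx i⟩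
  set η : ℕ → ProbabilityMeasure (X × (Fin n → X)) := fun j => selectionPlan (hB j).1 (γ j) with hη
  obtain ⟨φ, ηlim, hφ, hlim⟩ := exists_subseq_tendsto_of_forall_ae_mem
    (hL.prod (isCompact_univ_pi fun _ : Fin n => hK)) η fun j => hsel (hγ j).1 (hμsK j) j
  set νlim : ProbabilityMeasure X := ηlim.map measurable_fst.aemeasurable with hνlim
  have hηfst : ∀ j, (η j).map measurable_fst.aemeasurable = ν j := fun j =>
    Subtype.ext ((map_fst_selectionPlan (hB j).1 (γ j)).trans (hνB j).symm)
  have hνφ : Tendsto (fun k => ν (φ k)) atTop (𝓝 νlim) := by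
    simpa only [hηfst] using
      ProbabilityMeasure.tendsto_map_of_tendsto_of_continuous _ _ hlim continuous_fst
  have hηlim₂ : ∀ i, (ηlim : Measure (X × (Fin n → X))).map (fun p => p.2 i) = μ i := fun i => by
    have hcont : Continuous fun p : X × (Fin n → X) => p.2 i := by fun_prop
    have h1 := ProbabilityMeasure.tendsto_map_of_tendsto_of_continuous _ _ hlim hcont
    have h2 : ∀ j, (η j).map hcont.measurable.aemeasurable = μs j i := fun j =>
      Subtype.ext (map_eval_selectionPlan (hB j).1 (hγ j).1 i)
    simp only [h2] at h1
    exact congrArg ProbabilityMeasure.toMeasure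
      (tendsto_nhds_unique h1 ((hμs i).comp hφ.tendsto_atTop))
  have hνL : ∀ᵐ x ∂(νlim : Measure X), x ∈ L := by
    refine ae_mem_of_tendsto hL.isClosed hνφ fun k => ?_
    rw [← hηfst]
    refine (ae_map_iff measurable_fst.aemeasurable hL.measurableSet).2 ?_
    filter_upwards [hsel (hγ (φ k)).1 (hμsK _) (φ k)] with p hp using hp.1
  refine ⟨φ, hφ, νlim, ⟨fun ν' _ => ?_, mem_finiteMoment_of_ae_mem hh hL hνL⟩, hνφ⟩
  change barycenterFunctional h w μ νlim ≤ barycenterFunctional h w μ ν'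
  refine ENNReal.le_of_forall_pos_le_add fun ε hε _ => ?_
  obtain ⟨σ, hσ, hσle⟩ := exists_multiPlan_lintegral_multiCost_le hh hw hsum μ ν' (half_pos hε)
  -- `ν'` need not be compactly supported; pushing `σ` through any selection, here `B 0`, gives a
  -- competitor carried by `L` at no greater cost than `∫ C dσ`.
  set ξ : ProbabilityMeasure (X × (Fin n → X)) := selectionPlan (hB 0).1 σ with hξ
  set ν'' : ProbabilityMeasure X := ξ.map measurable_fst.aemeasurable with hν''
  have hν''L : ∀ᵐ x ∂(ν'' : Measure X), x ∈ L := by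
    refine (ae_map_iff measurable_fst.aemeasurable hL.measurableSet).2 ?_
    filter_upwards [hsel hσ hμK 0] with p hp using hp.1
  have hev := eventually_barycenterFunctional_le hL hh hw hsum hμs
    (fun i => (hμK i).mono fun _ hx => hKL hx) (fun j i => (hμsK j i).mono fun _ hx => hKL hx)
    hν''L ξ rfl (fun i => map_eval_selectionPlan (hB 0).1 hσ i) (half_pos hε)
  calc barycenterFunctional h w μ νlim
      ≤ ∫⁻ p, ENNReal.ofReal (pointObjective h w p.2 p.1)
          ∂(ηlim : Measure (X × (Fin n → X))) :=
        barycenterFunctional_le_lintegral_pointObjective hh hw0 ηlim rfl hηlim₂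
    _ ≤ liminf (fun k => ∫⁻ p, ENNReal.ofReal (pointObjective h w p.2 p.1)
          ∂(η (φ k) : Measure (X × (Fin n → X)))) atTop :=
        lintegral_le_liminf_lintegral_of_forall_isOpen_measure_le_liminf_measure
          (continuous_pointObjective hh) (fun p => pointObjective_nonneg hh hw0 _ _)
          fun G hG => ProbabilityMeasure.le_liminf_measure_open_of_tendsto hlim hG
    _ ≤ barycenterFunctional h w μ ν' + ε := by
        refine liminf_le_of_frequently_le' (Eventually.frequently ?_)
        filter_upwards [hφ.tendsto_atTop.eventually hev] with k hk
        rw [lintegral_pointObjective_selectionPlan hh hw0 (hB (φ k))]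
        refine ((hγ (φ k)).lintegral_multiCost_le hh hw hsum ν'').trans (hk.trans ?_)
        rw [lintegral_pointObjective_selectionPlan hh hw0 (hB 0)]
        refine (add_le_add_left hσle _).trans_eq ?_
        rw [add_assoc, ← ENNReal.coe_add, add_halves]

end HBarycenter

theorem mainTheorem9
    {E : Type*} [NormedAddCommGroup E] [NormedSpace ℝ E] [FiniteDimensional ℝ E]
    {H : Type*} [TopologicalSpace H] (I : ModelWithCorners ℝ E H)
    {M : Type*} [MetricSpace M] [ChartedSpace H M] [IsManifold I ∞ M] [BoundarylessManifold I M]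
    [Bundle.RiemannianBundle (fun x : M => TangentSpace I x)]
    [IsContMDiffRiemannianBundle I ∞ E (fun x : M => TangentSpace I x)]
    [IsRiemannianManifold I M] [CompleteSpace M]
    [MeasurableSpace M] [BorelSpace M]
    (h : ℝ → ℝ) (hh : HBarycenter.IsCostProfile h)
    (n : ℕ) (hn : 2 ≤ n)
    (w : Fin n → ℝ) (hw : ∀ i, 0 < w i) (hw_sum : ∑ i, w i = 1)
    (μ : Fin n → ProbabilityMeasure M) (μs : ℕ → Fin n → ProbabilityMeasure M)
    (hμs : ∀ i, Tendsto (fun j => μs j i) atTop (𝓝 (μ i)))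
    (K : Set M) (hK : IsCompact K)
    (hμK : ∀ i, (μ i : Measure M).support ⊆ K)
    (hμsK : ∀ j i, (μs j i : Measure M).support ⊆ K)
    (ν : ℕ → ProbabilityMeasure M)
    (hν : ∀ j, HBarycenter.IsConstructedBarycenter h w (μs j) (ν j)) :
    ∃ φ : ℕ → ℕ, StrictMono φ ∧
      ∃ νlim : ProbabilityMeasure M,
        HBarycenter.IsWassersteinBarycenter h w μ νlim ∧
          Tendsto (fun k => ν (φ k)) atTop (𝓝 νlim) := by
  have : ProperSpace M := HBarycenter.properSpace_of_isRiemannianManifold I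
  -- A proper space is second countable, so each measure is carried by its support.
  have hsupp : ∀ m : ProbabilityMeasure M, (m : Measure M).support ⊆ K →
      ∀ᵐ x ∂(m : Measure M), x ∈ K := fun m hm =>
    Filter.mem_of_superset Measure.support_mem_ae hm
  exact HBarycenter.exists_subseq_tendsto_isWassersteinBarycenter hh hw hw_sum hμs hK
    (fun i => hsupp _ (hμK i)) (fun j i => hsupp _ (hμsK j i)) hν
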